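/- Let $n\ge 0$ and $p\ge n+2$ be integers, let $\sigma\ge 0$, and let $w_1^*,w_2^*\in\mathbb{R}^p$. For $t=1,2$ let $X_t$ be a random $p\times n$ matrix whose entries are standard Gaussian $\mathcal N(0,1)$, and let $z_t\sim\mathcal N(0,\sigma^2 I_n)$; all entries of $X_1,X_2,z_1,z_2$ are jointly independent. Put $y_t=X_t^\top w_t^*+z_t$. Two tasks are learned one after the other: $w_0=0$, and for $t=1,2$ the model $w_t$ is the solution of $$\min_{w\in\mathbb{R}^p}\ \|w-w_{t-1}\|_2\quad\text{subject to}\quad X_t^\top w=y_t .$$ Define the forgetting $F_2=\|w_2-w_1^*\|^2-\|w_1-w_1^*\|^2$, the overall generalization error $G_2=\tfrac12\left(\|w_2-w_1^*\|^2+\|w_2-w_2^*\|^2\right)$, and $r=1-\frac np$. Then almost surely both minimization problems have a unique solution, so that $w_1,w_2$ are almost surely well defined; $F_2$ and $G_2$ are integrable; and $$\mathbb{E}[F_2]=(r^2-r)\|w_1^*\|^2+\frac np\|w_2^*-w_1^*\|^2+\frac{nr\sigma^2}{p-n-1},$$ $$\mathbb{E}[G_2]=\frac{r^2}{2}\left(\|w_1^*\|^2+\|w_2^*\|^2\right)+\frac{1-r^2}{2}\|w_1^*-w_2^*\|^2+\frac{p\sigma^2(1-r^2)}{p-n-1}.$$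 -/

import Mathlib

open MeasureTheory ProbabilityTheory
open scoped Matrix NNReal

noncomputable section

namespace ContinualLearning

/-- The responses `y = Xᵀ w* + z`; the columns of `X` are the `n` training feature vectors. -/
def labels {p n : ℕ} (X : Matrix (Fin p) (Fin n) ℝ) (wstar : EuclideanSpace ℝ (Fin p))
    (z : Fin n → ℝ) : Fin n → ℝ :=
  Xᵀ *ᵥ wstar.ofLp + z

/-- `w` solves the problem: minimize `‖w - v‖₂` subject to `Xᵀ w = y`. -/
structure IsMinChange {p n : ℕ} (X : Matrix (Fin p) (Fin n) ℝ) (y : Fin n → ℝ)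
    (v w : EuclideanSpace ℝ (Fin p)) : Prop where
  interpolates : Xᵀ *ᵥ w.ofLp = y
  minimal : ∀ u : EuclideanSpace ℝ (Fin p), Xᵀ *ᵥ u.ofLp = y → ‖w - v‖ ≤ ‖u - v‖

open Classical in
/-- The result of training on `(X, y)` from the initial point `v`: the solution of the problem
above. If the constraint is infeasible there is no solution, and the value is set to `v`. -/
def train {p n : ℕ} (X : Matrix (Fin p) (Fin n) ℝ) (y : Fin n → ℝ)
    (v : EuclideanSpace ℝ (Fin p)) : EuclideanSpace ℝ (Fin p) :=
  if h : ∃ w, IsMinChange X y v w then h.choose else v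

/-- The models `w₀ = 0, w₁, …, w_T` obtained by training on the `T` tasks one after another.
The tasks are numbered from `0` as elements of `Fin T`: `learned X y t.castSucc` is the model
before training on task `t`, and `learned X y t.succ` the model right after it. -/
def learned {T p n : ℕ} (X : Fin T → Matrix (Fin p) (Fin n) ℝ) (y : Fin T → Fin n → ℝ) :
    Fin (T + 1) → EuclideanSpace ℝ (Fin p) :=
  Fin.induction 0 fun t w => train (X t) (y t) w

/-- The model error of `w` on the task with ground truth `wstar`. -/
def modelError {p : ℕ} (wstar w : EuclideanSpace ℝ (Fin p)) : ℝ :=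
  ‖w - wstar‖ ^ 2

/-- The forgetting `F_T` after the last of the `T` tasks, averaged over the `T - 1` old ones. -/
def forgetting {T p : ℕ} (wstar : Fin T → EuclideanSpace ℝ (Fin p))
    (w : Fin (T + 1) → EuclideanSpace ℝ (Fin p)) : ℝ :=
  1 / ((T : ℝ) - 1) * ∑ i ∈ Finset.univ.filter (fun i : Fin T => (i : ℕ) + 1 < T),
    (modelError (wstar i) (w (Fin.last T)) - modelError (wstar i) (w i.succ))

/-- The overall generalization error `G_T` of the final model. -/
def generalizationError {T p : ℕ} (wstar : Fin T → EuclideanSpace ℝ (Fin p))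
    (w : Fin (T + 1) → EuclideanSpace ℝ (Fin p)) : ℝ :=
  1 / (T : ℝ) * ∑ i : Fin T, modelError (wstar i) (w (Fin.last T))

/-- All entries of all feature matrices `X t` are standard Gaussian, all entries of all noise
vectors `z t` are `N(0, σ²)`, and all these random variables together are independent. -/
structure IsGaussianData {Ω : Type*} [MeasurableSpace Ω] (μ : Measure Ω) {T p n : ℕ} (σ : ℝ)
    (X : Fin T → Ω → Matrix (Fin p) (Fin n) ℝ) (z : Fin T → Ω → Fin n → ℝ) : Prop where
  features_law : ∀ t k j, HasLaw (fun ω => X t ω k j) (gaussianReal 0 1) μ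
  noise_law : ∀ t j, HasLaw (fun ω => z t ω j) (gaussianReal 0 (σ ^ 2).toNNReal) μ
  indep : iIndepFun
    (fun (s : (Fin T × Fin p × Fin n) ⊕ (Fin T × Fin n)) (ω : Ω) =>
      Sum.elim (fun a => X a.1 ω a.2.1 a.2.2) (fun b => z b.1 ω b.2) s) μ

/-- The random sequence of learned models for the data `X t ω`, `y t = (X t ω)ᵀ w*_t + z t ω`. -/
def learnedModels {Ω : Type*} {T p n : ℕ} (wstar : Fin T → EuclideanSpace ℝ (Fin p))
    (X : Fin T → Ω → Matrix (Fin p) (Fin n) ℝ) (z : Fin T → Ω → Fin n → ℝ) (ω : Ω) :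
    Fin (T + 1) → EuclideanSpace ℝ (Fin p) :=
  learned (fun t => X t ω) (fun t => labels (X t ω) (wstar t) (z t ω))

end ContinualLearning

end

/-! Write `H = hat X` and `G = Xᵀ * X`. Almost surely `G` is invertible, and training from `v` gives
`v + pinv X (y - Xᵀ v)`. Relative to any target `u`, the part of `v - u` orthogonal to the columns
of `X` is kept, and the part in the column space is replaced by `H (a - u) + pinv X z`, where `a` is
the ground truth. Pythagoras yields `step_sub_dotProduct_self`.

If `v` is independent of `X`, and `X` of the centred noise `z`, taking expectations requires only `E
H = (n/p) I` (`integral_hat`) and `E (G⁻¹) j j = 1/(p - n - 1)` (`integrable_inv_gram_diag`). The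
result is the affine recursion `integral_step`: `E‖w - u‖² = r E‖v - u‖² + (n/p) ‖a - u‖² + n σ²/(p
- n - 1)`. Using it twice, from `v = 0`, with `u` either ground truth, gives both formulas.

`E H` is diagonal by sign changes of rows, scalar by permutations of rows, and has trace `n`. The
entry `(G⁻¹) j j` is the inverse squared distance of column `j` from the span of the others
(`inv_gram_diag`). That squared distance is chi-square with `k = p - n + 1` degrees of freedom, and
its inverse has mean `1/(k - 2)`. -/

namespace ContinualLearning

open scoped ENNReal RealInnerProductSpace

/-! ### Inverse moments of chi-square variables and Gaussian projections. -/

section InverseChiSquare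

/-- The Laplace transform of the square of a standard Gaussian variable. -/
lemma integral_exp_neg_mul_sq_gaussianReal {t : ℝ} (ht : 0 ≤ t) :
    ∫ x, Real.exp (-t * x ^ 2) ∂(gaussianReal 0 1) = (1 + 2 * t) ^ (-(1 / 2) : ℝ) := by
  have h1 : (0 : ℝ) < 1 + 2 * t := by positivity
  rw [integral_gaussianReal_eq_integral_smul one_ne_zero]
  have h2 : ∀ x : ℝ, gaussianPDFReal 0 1 x • Real.exp (-t * x ^ 2) =
      (√(2 * Real.pi))⁻¹ * Real.exp (-((1 + 2 * t) / 2) * x ^ 2) := by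
    intro x
    simp only [gaussianPDFReal_def, smul_eq_mul, NNReal.coe_one, mul_one, sub_zero, mul_assoc]
    rw [← Real.exp_add]
    congr 2
    ring
  simp_rw [h2]
  rw [integral_const_mul, integral_gaussian, ← Real.sqrt_inv, ← Real.sqrt_mul (by positivity),
    Real.rpow_neg h1.le, ← Real.sqrt_eq_rpow, ← Real.sqrt_inv]
  congr 1
  field_simp

/-- `∫₀^∞ exp (-t s) dt = 1 / s`, with the value `∞` at `s = 0`. -/
lemma lintegral_exp_neg_mul_Ioi {s : ℝ} (hs : 0 ≤ s) :
    ∫⁻ t in Set.Ioi (0 : ℝ), ENNReal.ofReal (Real.exp (-t * s)) = (ENNReal.ofReal s)⁻¹ := by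
  rcases hs.eq_or_lt with rfl | hs
  · simp
  · have h1 : ∀ t : ℝ, -t * s = (-s) * t := fun t => by ring
    simp_rw [h1]
    rw [← ofReal_integral_eq_lintegral_ofReal, integral_exp_mul_Ioi (by linarith),
      ← ENNReal.ofReal_inv_of_pos hs]
    · simp
    · simpa only [IntegrableOn] using exp_neg_integrableOn_Ioi 0 hs
    · exact ae_of_all _ fun t => (Real.exp_pos _).le

/-- The primitive is a multiple of `(1 + 2t) ^ (1 - k/2)`, which vanishes at infinity exactly
because `k > 2`. -/
lemma lintegral_one_add_two_mul_rpow {k : ℝ} (hk : 2 < k) :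
    ∫⁻ t in Set.Ioi (0 : ℝ), ENNReal.ofReal ((1 + 2 * t) ^ (-(k / 2))) =
      ENNReal.ofReal (1 / (k - 2)) := by
  have hd : ∀ t ∈ Set.Ici (0 : ℝ), HasDerivAt
      (fun t : ℝ => -(1 / (k - 2)) * (1 + 2 * t) ^ (-(k / 2) + 1))
      ((1 + 2 * t) ^ (-(k / 2))) t := by
    intro t ht
    have ht : (0 : ℝ) ≤ t := ht
    have h1 : HasDerivAt (fun t : ℝ => 1 + 2 * t) 2 t := by
      simpa using ((hasDerivAt_id t).const_mul 2).const_add 1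
    have h2 := (h1.rpow_const (p := -(k / 2) + 1) (Or.inl (by positivity))).const_mul
      (-(1 / (k - 2)))
    convert! h2 using 1
    have : k - 2 ≠ 0 := by linarith
    rw [add_sub_cancel_right]
    field_simp
    ring
  have hlim : Filter.Tendsto (fun t : ℝ => -(1 / (k - 2)) * (1 + 2 * t) ^ (-(k / 2) + 1))
      Filter.atTop (nhds (-(1 / (k - 2)) * 0)) := by
    refine Filter.Tendsto.const_mul _ ?_
    have h3 : -(k / 2) + 1 = -(k / 2 - 1) := by ring
    rw [h3]
    refine (tendsto_rpow_neg_atTop (by linarith)).comp ?_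
    exact Filter.tendsto_atTop_add_const_left _ _
      (Filter.tendsto_id.const_mul_atTop (by norm_num))
  have hpos : ∀ t ∈ Set.Ioi (0 : ℝ), 0 ≤ (1 + 2 * t) ^ (-(k / 2)) := by
    intro t ht
    have ht : (0 : ℝ) < t := ht
    positivity
  have hint := integrableOn_Ioi_deriv_of_nonneg' hd hpos hlim
  rw [← ofReal_integral_eq_lintegral_ofReal hint
    ((ae_restrict_iff' measurableSet_Ioi).2 (ae_of_all _ hpos)),
    integral_Ioi_of_hasDerivAt_of_tendsto' hd hint hlim]
  simp

/-- The expectation of the inverse of a chi-square variable with `k ≥ 3` degrees of freedom. -/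
lemma lintegral_inv_sum_sq_gaussian {ι : Type*} [Fintype ι] (hk : 2 < Fintype.card ι) :
    ∫⁻ x : ι → ℝ, (ENNReal.ofReal (∑ i, x i ^ 2))⁻¹ ∂(Measure.pi fun _ => gaussianReal 0 1) =
      ENNReal.ofReal (1 / ((Fintype.card ι : ℝ) - 2)) := by
  -- Writing `1/s` as an integral of `exp (-t s)` reduces the mean, by Tonelli, to the Laplace
  -- transform, which factors over the coordinates.
  have h1 : ∀ x : ι → ℝ, (ENNReal.ofReal (∑ i, x i ^ 2))⁻¹ =
      ∫⁻ t in Set.Ioi (0 : ℝ), ENNReal.ofReal (Real.exp (-t * ∑ i, x i ^ 2)) := fun x =>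
    (lintegral_exp_neg_mul_Ioi (Finset.sum_nonneg fun i _ => sq_nonneg _)).symm
  simp_rw [h1]
  rw [lintegral_lintegral_swap (by fun_prop),
    ← lintegral_one_add_two_mul_rpow (by exact_mod_cast hk)]
  refine setLIntegral_congr_fun measurableSet_Ioi fun t ht => ?_
  have ht : (0 : ℝ) < t := ht
  have h2 : ∀ x : ι → ℝ, Real.exp (-t * ∑ i, x i ^ 2) = ∏ i, Real.exp (-t * x i ^ 2) := by
    intro x
    rw [Finset.mul_sum, Real.exp_sum]
  rw [← ofReal_integral_eq_lintegral_ofReal]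
  · simp_rw [h2]
    rw [integral_fintype_prod_eq_prod (f := fun (_ : ι) (x : ℝ) => Real.exp (-t * x ^ 2))]
    simp_rw [integral_exp_neg_mul_sq_gaussianReal ht.le]
    rw [Finset.prod_const, Finset.card_univ, ← Real.rpow_natCast, ← Real.rpow_mul (by positivity)]
    congr 2
    ring
  · refine Integrable.of_bound (Measurable.aestronglyMeasurable (by fun_prop)) 1
      (ae_of_all _ fun x => ?_)
    rw [Real.norm_eq_abs, Real.abs_exp, Real.exp_le_one_iff]
    have : 0 ≤ ∑ i, x i ^ 2 := Finset.sum_nonneg fun i _ => sq_nonneg _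
    nlinarith
  · exact ae_of_all _ fun x => (Real.exp_pos _).le

variable {E : Type*} [NormedAddCommGroup E] [InnerProductSpace ℝ E] [FiniteDimensional ℝ E]
  [MeasurableSpace E] [BorelSpace E]

/-- The orthogonal projection of a standard Gaussian vector is standard Gaussian. -/
lemma stdGaussian_map_orthogonalProjection (K : Submodule ℝ E) :
    (stdGaussian E).map K.orthogonalProjectionOnto = stdGaussian K := by
  apply Measure.ext_of_charFun
  ext t
  rw [charFun_apply, integral_map (by fun_prop) (by fun_prop), charFun_stdGaussian]
  have h : ∀ x : E, ⟪K.orthogonalProjectionOnto x, t⟫ = ⟪x, (t : E)⟫ := fun x =>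
    Submodule.inner_orthogonalProjectionOnto_eq_of_mem_right t x
  simp_rw [h]
  rw [← charFun_apply, charFun_stdGaussian]
  simp

/-- The expected inverse square of the length of the projection of a standard Gaussian vector. -/
lemma lintegral_inv_norm_orthogonalProjection_sq (K : Submodule ℝ E)
    (hK : 2 < Module.finrank ℝ K) :
    ∫⁻ x, (ENNReal.ofReal (‖K.orthogonalProjectionOnto x‖ ^ 2))⁻¹ ∂(stdGaussian E) =
      ENNReal.ofReal (1 / ((Module.finrank ℝ K : ℝ) - 2)) := by
  have h1 : ∫⁻ x, (ENNReal.ofReal (‖K.orthogonalProjectionOnto x‖ ^ 2))⁻¹ ∂(stdGaussian E) =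
      ∫⁻ y, (ENNReal.ofReal (‖y‖ ^ 2))⁻¹ ∂(stdGaussian K) := by
    rw [← stdGaussian_map_orthogonalProjection K, lintegral_map (by fun_prop) (by fun_prop)]
  have b := stdOrthonormalBasis ℝ K
  rw [h1, stdGaussian_eq_map_pi_orthonormalBasis b, lintegral_map (by fun_prop) (by fun_prop)]
  have h2 : ∀ x : Fin (Module.finrank ℝ K) → ℝ, ‖∑ i, x i • b i‖ ^ 2 = ∑ i, x i ^ 2 := by
    intro x
    rw [← b.sum_sq_inner_right]
    refine Finset.sum_congr rfl fun i _ => ?_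
    rw [inner_sum, Finset.sum_eq_single i]
    · rw [real_inner_smul_right, real_inner_self_eq_norm_sq, b.norm_eq_one, one_pow, mul_one]
    · intro j _ hj
      rw [real_inner_smul_right, b.inner_eq_zero hj.symm, mul_zero]
    · simp
  simp_rw [h2]
  rw [lintegral_inv_sum_sq_gaussian (by simpa using hK), Fintype.card_fin]

end InverseChiSquare

/-! ### Linear algebra of minimum-norm interpolation and of the inverse Gram matrix. -/

section LeastSquares

variable {p n : ℕ}

/-- The pseudo-inverse of `Xᵀ` for `X` of full column rank. -/
noncomputable def pinv (X : Matrix (Fin p) (Fin n) ℝ) : Matrix (Fin p) (Fin n) ℝ :=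
  X * (Xᵀ * X)⁻¹

/-- The orthogonal projection onto the column space of `X`, for `X` of full column rank. -/
noncomputable def hat (X : Matrix (Fin p) (Fin n) ℝ) : Matrix (Fin p) (Fin p) ℝ :=
  pinv X * Xᵀ

/-- The interpolator of `y` closest to `v`, for `X` of full column rank. -/
noncomputable def step (X : Matrix (Fin p) (Fin n) ℝ) (y : Fin n → ℝ) (v : Fin p → ℝ) :
    Fin p → ℝ :=
  v + pinv X *ᵥ (y - Xᵀ *ᵥ v)

lemma inv_gram_transpose (X : Matrix (Fin p) (Fin n) ℝ) : ((Xᵀ * X)⁻¹)ᵀ = (Xᵀ * X)⁻¹ := by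
  rw [Matrix.transpose_nonsing_inv, Matrix.transpose_mul, Matrix.transpose_transpose]

lemma hat_transpose (X : Matrix (Fin p) (Fin n) ℝ) : (hat X)ᵀ = hat X := by
  rw [hat, pinv, Matrix.transpose_mul, Matrix.transpose_mul, inv_gram_transpose,
    Matrix.transpose_transpose, Matrix.mul_assoc]

lemma transpose_mul_pinv {X : Matrix (Fin p) (Fin n) ℝ} (hX : IsUnit (Xᵀ * X).det) :
    Xᵀ * pinv X = 1 := by
  rw [pinv, ← Matrix.mul_assoc, Matrix.mul_nonsing_inv _ hX]

lemma hat_mul_pinv {X : Matrix (Fin p) (Fin n) ℝ} (hX : IsUnit (Xᵀ * X).det) :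
    hat X * pinv X = pinv X := by
  rw [hat, Matrix.mul_assoc, transpose_mul_pinv hX, Matrix.mul_one]

lemma hat_mul_hat {X : Matrix (Fin p) (Fin n) ℝ} (hX : IsUnit (Xᵀ * X).det) :
    hat X * hat X = hat X := by
  have : pinv X * Xᵀ * (pinv X * Xᵀ) = pinv X * Xᵀ := by
    rw [Matrix.mul_assoc, ← Matrix.mul_assoc Xᵀ, transpose_mul_pinv hX, Matrix.one_mul]
  exact this

lemma pinv_transpose_mul_pinv {X : Matrix (Fin p) (Fin n) ℝ} (hX : IsUnit (Xᵀ * X).det) :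
    (pinv X)ᵀ * pinv X = (Xᵀ * X)⁻¹ := by
  conv_lhs => rw [pinv, Matrix.transpose_mul, inv_gram_transpose, Matrix.mul_assoc, ← pinv,
    transpose_mul_pinv hX, Matrix.mul_one]

lemma trace_hat {X : Matrix (Fin p) (Fin n) ℝ} (hX : IsUnit (Xᵀ * X).det) :
    (hat X).trace = n := by
  rw [hat, Matrix.trace_mul_comm, transpose_mul_pinv hX, Matrix.trace_one, Fintype.card_fin]

lemma transpose_mulVec_step {X : Matrix (Fin p) (Fin n) ℝ} (hX : IsUnit (Xᵀ * X).det)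
    (y : Fin n → ℝ) (v : Fin p → ℝ) : Xᵀ *ᵥ step X y v = y := by
  rw [step, Matrix.mulVec_add, Matrix.mulVec_mulVec, transpose_mul_pinv hX, Matrix.one_mulVec]
  abel

lemma mulVec_dotProduct {m k : Type*} [Fintype m] [Fintype k] (B : Matrix m k ℝ) (x : k → ℝ)
    (y : m → ℝ) : (B *ᵥ x) ⬝ᵥ y = x ⬝ᵥ (Bᵀ *ᵥ y) := by
  rw [Matrix.dotProduct_mulVec, Matrix.vecMul_transpose]

lemma dotProduct_pinv_mulVec_eq_zero (X : Matrix (Fin p) (Fin n) ℝ) {d : Fin p → ℝ}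
    (hd : Xᵀ *ᵥ d = 0) (c : Fin n → ℝ) : d ⬝ᵥ (pinv X *ᵥ c) = 0 := by
  rw [dotProduct_comm, mulVec_dotProduct, pinv, Matrix.transpose_mul, ← Matrix.mulVec_mulVec, hd,
    Matrix.mulVec_zero, dotProduct_zero]

lemma norm_sq_eq_dotProduct {ι : Type*} [Fintype ι] (x : EuclideanSpace ℝ ι) :
    ‖x‖ ^ 2 = x.ofLp ⬝ᵥ x.ofLp := by
  rw [EuclideanSpace.real_norm_sq_eq]
  simp [dotProduct, sq]

/-- For `X` of full column rank the minimization problem has the unique solution `step X y v`. -/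
lemma isMinChange_iff {X : Matrix (Fin p) (Fin n) ℝ} (hX : IsUnit (Xᵀ * X).det) (y : Fin n → ℝ)
    (v w : EuclideanSpace ℝ (Fin p)) :
    IsMinChange X y v w ↔ w = WithLp.toLp 2 (step X y v.ofLp) := by
  -- Pythagoras: `u - step` is killed by `Xᵀ`, while `step - v` lies in the column space of `X`.
  have key : ∀ u : EuclideanSpace ℝ (Fin p), Xᵀ *ᵥ u.ofLp = y →
      ‖u - v‖ ^ 2 = ‖u - WithLp.toLp 2 (step X y v.ofLp)‖ ^ 2 +
        ‖WithLp.toLp 2 (step X y v.ofLp) - v‖ ^ 2 := by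
    intro u hu
    have h0 : (u.ofLp - step X y v.ofLp) ⬝ᵥ (step X y v.ofLp - v.ofLp) = 0 := by
      have : step X y v.ofLp - v.ofLp = pinv X *ᵥ (y - Xᵀ *ᵥ v.ofLp) := by
        rw [step]; abel
      rw [this]
      refine dotProduct_pinv_mulVec_eq_zero X ?_ _
      rw [Matrix.mulVec_sub, hu, transpose_mulVec_step hX, sub_self]
    have h1 : u.ofLp - v.ofLp = (u.ofLp - step X y v.ofLp) + (step X y v.ofLp - v.ofLp) := by
      abel
    simp only [norm_sq_eq_dotProduct, WithLp.ofLp_sub]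
    rw [h1, add_dotProduct, dotProduct_add, dotProduct_add, h0, dotProduct_comm (step X y v.ofLp -
      v.ofLp) (u.ofLp - _), h0]
    ring
  constructor
  · intro h
    have h1 := h.minimal (WithLp.toLp 2 (step X y v.ofLp)) (transpose_mulVec_step hX _ _)
    have h2 := key w h.interpolates
    have h3 := pow_le_pow_left₀ (norm_nonneg _) h1 2
    have h4 : ‖w - WithLp.toLp 2 (step X y v.ofLp)‖ ^ 2 = 0 :=
      le_antisymm (by linarith) (sq_nonneg _)
    exact sub_eq_zero.1 (norm_eq_zero.1 (pow_eq_zero_iff two_ne_zero |>.1 h4))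
  · rintro rfl
    refine ⟨transpose_mulVec_step hX _ _, fun u hu => ?_⟩
    refine le_of_sq_le_sq ?_ (norm_nonneg _)
    rw [key u hu]
    exact le_add_of_nonneg_left (sq_nonneg _)

lemma train_eq_step {X : Matrix (Fin p) (Fin n) ℝ} (hX : IsUnit (Xᵀ * X).det) (y : Fin n → ℝ)
    (v : EuclideanSpace ℝ (Fin p)) : train X y v = WithLp.toLp 2 (step X y v.ofLp) := by
  have h : ∃ w, IsMinChange X y v w := ⟨_, (isMinChange_iff hX y v _).2 rfl⟩
  rw [train, dif_pos h]
  exact (isMinChange_iff hX y v _).1 h.choose_spec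

/-- The squared distance from `u` to the result of training from `v` on the labels
`Xᵀ a + z`. -/
lemma step_sub_dotProduct_self {X : Matrix (Fin p) (Fin n) ℝ} (hX : IsUnit (Xᵀ * X).det)
    (a u v : Fin p → ℝ) (z : Fin n → ℝ) :
    (step X (Xᵀ *ᵥ a + z) v - u) ⬝ᵥ (step X (Xᵀ *ᵥ a + z) v - u) =
      (v - u) ⬝ᵥ (v - u) - (v - u) ⬝ᵥ (hat X *ᵥ (v - u)) + (a - u) ⬝ᵥ (hat X *ᵥ (a - u)) +
        2 * ((a - u) ⬝ᵥ (pinv X *ᵥ z)) + z ⬝ᵥ ((Xᵀ * X)⁻¹ *ᵥ z) := by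
  -- The first bracket is orthogonal to the column space, the second lies in it, so their cross
  -- terms vanish.
  have h1 : step X (Xᵀ *ᵥ a + z) v - u =
      ((v - u) - hat X *ᵥ (v - u)) + (hat X *ᵥ (a - u) + pinv X *ᵥ z) := by
    simp only [step, hat, ← Matrix.mulVec_mulVec, Matrix.mulVec_add, Matrix.mulVec_sub]
    abel
  generalize v - u = b at *
  generalize a - u = c at *
  have hPP : ∀ x y : Fin p → ℝ, (hat X *ᵥ x) ⬝ᵥ (hat X *ᵥ y) = x ⬝ᵥ (hat X *ᵥ y) := by
    intro x y
    rw [mulVec_dotProduct, hat_transpose, Matrix.mulVec_mulVec, hat_mul_hat hX]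
  have hPA : ∀ x, (hat X *ᵥ x) ⬝ᵥ (pinv X *ᵥ z) = x ⬝ᵥ (pinv X *ᵥ z) := by
    intro x
    rw [mulVec_dotProduct, hat_transpose, Matrix.mulVec_mulVec, hat_mul_pinv hX]
  have hAA : (pinv X *ᵥ z) ⬝ᵥ (pinv X *ᵥ z) = z ⬝ᵥ ((Xᵀ * X)⁻¹ *ᵥ z) := by
    rw [mulVec_dotProduct, Matrix.mulVec_mulVec, pinv_transpose_mul_pinv hX]
  have hs : (hat X *ᵥ b) ⬝ᵥ b = b ⬝ᵥ (hat X *ᵥ b) := dotProduct_comm _ _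
  have hd : ((b - hat X *ᵥ b) ⬝ᵥ (hat X *ᵥ c + pinv X *ᵥ z)) = 0 := by
    rw [sub_dotProduct, dotProduct_add, dotProduct_add, hPP, hPA]
    ring
  rw [h1, add_dotProduct, dotProduct_add, dotProduct_add (hat X *ᵥ c + pinv X *ᵥ z), hd,
    dotProduct_comm (hat X *ᵥ c + pinv X *ᵥ z) (b - _), hd]
  simp only [sub_dotProduct, dotProduct_sub, add_dotProduct, dotProduct_add, hPP, hPA, hAA, hs,
    dotProduct_comm (pinv X *ᵥ z) (hat X *ᵥ c)]
  ring

/-- `|ab| ≤ (a² + b²)/2`, term by term. It controls off-diagonal entries of `G⁻¹` and `H` by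
diagonal ones. -/
lemma abs_transpose_mul_self_le {m k : Type*} [Fintype m] (B : Matrix m k ℝ) (i j : k) :
    |(Bᵀ * B) i j| ≤ ((Bᵀ * B) i i + (Bᵀ * B) j j) / 2 := by
  simp only [Matrix.mul_apply, Matrix.transpose_apply]
  refine (Finset.abs_sum_le_sum_abs _ _).trans ?_
  rw [← Finset.sum_add_distrib, Finset.sum_div]
  refine Finset.sum_le_sum fun x _ => ?_
  rw [abs_mul]
  nlinarith [sq_nonneg (|B x i| - |B x j|), sq_abs (B x i), sq_abs (B x j)]

lemma abs_inv_gram_le {X : Matrix (Fin p) (Fin n) ℝ} (hX : IsUnit (Xᵀ * X).det) (i j : Fin n) :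
    |(Xᵀ * X)⁻¹ i j| ≤ ((Xᵀ * X)⁻¹ i i + (Xᵀ * X)⁻¹ j j) / 2 := by
  rw [← pinv_transpose_mul_pinv hX]
  exact abs_transpose_mul_self_le _ i j

lemma inv_gram_diag_nonneg {X : Matrix (Fin p) (Fin n) ℝ} (hX : IsUnit (Xᵀ * X).det)
    (i : Fin n) : 0 ≤ (Xᵀ * X)⁻¹ i i := by
  have := (abs_nonneg _).trans (abs_inv_gram_le hX i i)
  linarith

/-- `G⁻¹ = (pinv X)ᵀ * pinv X`, so its `j`-th diagonal entry is the sum of the squares in column `j`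
of `pinv X`. -/
lemma pinv_sq_le {X : Matrix (Fin p) (Fin n) ℝ} (hX : IsUnit (Xᵀ * X).det) (k : Fin p)
    (j : Fin n) : pinv X k j ^ 2 ≤ (Xᵀ * X)⁻¹ j j := by
  rw [← pinv_transpose_mul_pinv hX, Matrix.mul_apply, sq]
  exact Finset.single_le_sum (f := fun k => (pinv X)ᵀ j k * pinv X k j)
    (fun k _ => mul_self_nonneg (pinv X k j)) (Finset.mem_univ k)

lemma abs_hat_le {X : Matrix (Fin p) (Fin n) ℝ} (hX : IsUnit (Xᵀ * X).det) (i j : Fin p) :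
    |hat X i j| ≤ 1 := by
  have h0 : (hat X)ᵀ * hat X = hat X := by rw [hat_transpose, hat_mul_hat hX]
  -- A symmetric idempotent has `H i i = ∑ k, (H k i)² ≥ (H i i)²`.
  have h1 : ∀ i, hat X i i ≤ 1 := by
    intro i
    have h2 : hat X i i ^ 2 ≤ hat X i i := by
      conv_rhs => rw [← h0, Matrix.mul_apply]
      rw [sq]
      exact Finset.single_le_sum (f := fun k => (hat X)ᵀ i k * hat X k i)
        (fun k _ => mul_self_nonneg (hat X k i)) (Finset.mem_univ i)
    nlinarith
  have h3 := abs_transpose_mul_self_le (hat X) i j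
  rw [h0] at h3
  linarith [h1 i, h1 j]

/-- `Xᵀ * X` and `X` have the same kernel; this makes invertibility a question of linear
independence of columns. -/
lemma isUnit_det_gram_iff (X : Matrix (Fin p) (Fin n) ℝ) :
    IsUnit (Xᵀ * X).det ↔ ∀ c : Fin n → ℝ, X *ᵥ c = 0 → c = 0 := by
  rw [← Matrix.isUnit_iff_isUnit_det, ← Matrix.mulVec_injective_iff_isUnit]
  have h := Matrix.ker_mulVecLin_transpose_mul_self X
  have h1 : Function.Injective (Xᵀ * X).mulVec ↔ (Xᵀ * X).mulVecLin.ker = ⊥ := by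
    rw [LinearMap.ker_eq_bot, Matrix.coe_mulVecLin]
  rw [h1, h, LinearMap.ker_eq_bot']
  rfl

/-- The orthogonal complement of the span of the columns of `Y`. -/
noncomputable def colOrth (Y : Matrix (Fin p) (Fin n) ℝ) :
    Submodule ℝ (EuclideanSpace ℝ (Fin p)) :=
  (Submodule.span ℝ (Set.range fun i => WithLp.toLp 2 (Y.col i)))ᗮ

lemma finrank_colOrth {Y : Matrix (Fin p) (Fin n) ℝ} (hY : IsUnit (Yᵀ * Y).det) :
    Module.finrank ℝ (colOrth Y) + n = p := by
  have hli : LinearIndependent ℝ (fun i => WithLp.toLp 2 (Y.col i)) := by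
    rw [Fintype.linearIndependent_iff]
    intro g hg
    refine congrFun ((isUnit_det_gram_iff Y).1 hY g ?_)
    have := congrArg WithLp.ofLp hg
    ext k
    have h2 := congrFun this k
    simpa [Matrix.mulVec, dotProduct, mul_comm, WithLp.ofLp_sum, Finset.sum_apply] using h2
  have h1 := finrank_span_eq_card hli
  have h2 := Submodule.finrank_add_finrank_orthogonal
    (Submodule.span ℝ (Set.range fun i => WithLp.toLp 2 (Y.col i)))
  rw [h1] at h2
  simp only [Fintype.card_fin, finrank_euclideanSpace] at h2
  exact (add_comm _ _).trans h2

/-- The diagonal entries of the inverse Gram matrix are the inverse squared distances of the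
columns from the span of the other columns. -/
lemma inv_gram_diag {X : Matrix (Fin p) (Fin (n + 1)) ℝ} (j : Fin (n + 1))
    (hY : IsUnit ((X.submatrix id j.succAbove)ᵀ * X.submatrix id j.succAbove).det)
    (hq : (colOrth (X.submatrix id j.succAbove)).orthogonalProjectionOnto
      (WithLp.toLp 2 (X.col j)) ≠ 0) :
    IsUnit (Xᵀ * X).det ∧ (Xᵀ * X)⁻¹ j j =
      (‖(colOrth (X.submatrix id j.succAbove)).orthogonalProjectionOnto
        (WithLp.toLp 2 (X.col j))‖ ^ 2)⁻¹ := by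
  set Y := X.submatrix id j.succAbove with hYdef
  set q := (colOrth Y).orthogonalProjectionOnto (WithLp.toLp 2 (X.col j)) with hqdef
  have hs : ‖q‖ ^ 2 ≠ 0 := by simpa using hq
  -- `q` is orthogonal to every column but the `j`-th, whose inner product with `q` is `‖q‖²`.
  have hXq : Xᵀ *ᵥ (q : EuclideanSpace ℝ (Fin p)).ofLp = ‖q‖ ^ 2 • Pi.single j 1 := by
    have hin : ∀ i, (Xᵀ *ᵥ (q : EuclideanSpace ℝ (Fin p)).ofLp) i =
        ⟪(q : EuclideanSpace ℝ (Fin p)), WithLp.toLp 2 (X.col i)⟫ := by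
      intro i
      simp [Matrix.mulVec, dotProduct, PiLp.inner_apply]
    ext i
    rw [hin]
    rcases eq_or_ne i j with rfl | hij
    · have h1 := Submodule.inner_orthogonalProjectionOnto_eq_of_mem_left q
        (WithLp.toLp 2 (X.col i))
      rw [← h1, ← hqdef, real_inner_self_eq_norm_sq]
      simp
    · obtain ⟨i, rfl⟩ := Fin.exists_succAbove_eq hij
      have h1 : WithLp.toLp 2 (X.col (j.succAbove i)) ∈
          Submodule.span ℝ (Set.range fun i => WithLp.toLp 2 (Y.col i)) :=
        Submodule.subset_span ⟨i, rfl⟩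
      have h2 := (Submodule.mem_orthogonal' _ _).1 q.2 _ h1
      rw [h2]
      simp [hij]
  -- `q` is column `j` minus a combination of the others, hence `X c` with `c j = 1`.
  obtain ⟨c, hcj, hc⟩ : ∃ c : Fin (n + 1) → ℝ, c j = 1 ∧
      X *ᵥ c = (q : EuclideanSpace ℝ (Fin p)).ofLp := by
    have h1 : WithLp.toLp 2 (X.col j) - (q : EuclideanSpace ℝ (Fin p)) ∈
        Submodule.span ℝ (Set.range fun i => WithLp.toLp 2 (Y.col i)) := by
      have := Submodule.sub_starProjection_mem_orthogonal (K := colOrth Y)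
        (WithLp.toLp 2 (X.col j))
      rwa [colOrth, Submodule.orthogonal_orthogonal] at this
    obtain ⟨d, hd⟩ := (Submodule.mem_span_range_iff_exists_fun ℝ).1 h1
    refine ⟨j.insertNth 1 (-d), by simp, ?_⟩
    have h2 : (q : EuclideanSpace ℝ (Fin p)) =
        WithLp.toLp 2 (X.col j) - ∑ i, d i • WithLp.toLp 2 (Y.col i) := by
      rw [hd]; abel
    rw [h2]
    ext k
    simp [Matrix.mulVec, dotProduct, Fin.sum_univ_succAbove _ j, WithLp.ofLp_sum,
      Finset.sum_apply, hYdef, mul_comm, sub_eq_add_neg]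
  have hunit : IsUnit (Xᵀ * X).det := by
    rw [isUnit_det_gram_iff]
    intro e he
    -- Pairing `X e = 0` with `q` isolates `e j`; what remains is a relation between the columns of
    -- `Y`.
    have hej : e j = 0 := by
      have h1 : e ⬝ᵥ (Xᵀ *ᵥ (q : EuclideanSpace ℝ (Fin p)).ofLp) = 0 := by
        rw [← mulVec_dotProduct, he, zero_dotProduct]
      rw [hXq] at h1
      simpa [hs, hq] using h1
    have h2 : Y *ᵥ (fun i => e (j.succAbove i)) = 0 := by
      ext k
      have := congrFun he k
      simpa [Matrix.mulVec, dotProduct, Fin.sum_univ_succAbove _ j, hej, hYdef] using this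
    have h3 := (isUnit_det_gram_iff Y).1 hY _ h2
    ext i
    rcases eq_or_ne i j with rfl | hij
    · exact hej
    · obtain ⟨i, rfl⟩ := Fin.exists_succAbove_eq hij
      exact congrFun h3 i
  refine ⟨hunit, ?_⟩
  -- Combining `Xᵀ q = ‖q‖² e_j` with `q = X c` gives `G c = ‖q‖² e_j`; entry `j` of the solution
  -- reads `1 = ‖q‖² (G⁻¹) j j`.
  have h4 : c = (Xᵀ * X)⁻¹ *ᵥ (‖q‖ ^ 2 • Pi.single j 1) := by
    rw [← hXq, ← hc, Matrix.mulVec_mulVec, Matrix.mulVec_mulVec, Matrix.mul_assoc,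
      Matrix.nonsing_inv_mul _ hunit, Matrix.one_mulVec]
  have h5 := congrFun h4 j
  rw [hcj, Matrix.mulVec_smul, Matrix.mulVec_single_one] at h5
  simp only [Pi.smul_apply, Matrix.col_apply, smul_eq_mul] at h5
  exact eq_inv_of_mul_eq_one_right h5.symm

end LeastSquares

/-! ### Expectations of `G⁻¹` and `H` for a standard Gaussian matrix. -/

section GaussianMatrix

/-- The images of `g` and `h` are disjoint finite index sets, so the corresponding blocks are
independent; reindexing is measurable and need not be injective. -/
lemma indepFun_precomp {Ω ι α β : Type*} [MeasurableSpace Ω] {μ : Measure Ω} [Fintype α]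
    [Fintype β] {f : ι → Ω → ℝ} (hf : iIndepFun f μ) (hm : ∀ i, AEMeasurable (f i) μ)
    (g : α → ι) (h : β → ι) (hgh : ∀ a b, g a ≠ h b) :
    IndepFun (fun ω a => f (g a) ω) (fun ω b => f (h b) ω) μ := by
  classical
  have hd : Disjoint (Finset.univ.image g) (Finset.univ.image h) := by
    rw [Finset.disjoint_left]
    intro i hi hi'
    obtain ⟨a, -, rfl⟩ := Finset.mem_image.1 hi
    obtain ⟨b, -, hb⟩ := Finset.mem_image.1 hi'
    exact hgh a b hb.symm
  have h1 := hf.indepFun_finset₀ _ _ hd hm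
  exact h1.comp
    (φ := fun (y : (Finset.univ.image g) → ℝ) a =>
      y ⟨g a, Finset.mem_image_of_mem g (Finset.mem_univ a)⟩)
    (ψ := fun (y : (Finset.univ.image h) → ℝ) b =>
      y ⟨h b, Finset.mem_image_of_mem h (Finset.mem_univ b)⟩)
    (by fun_prop) (by fun_prop)

/-- The law of a family of independent standard Gaussian variables. -/
noncomputable abbrev stdPi (ι : Type*) [Fintype ι] : Measure (ι → ℝ) :=
  Measure.pi fun _ => gaussianReal 0 1

lemma iIndepFun_stdPi (ι : Type*) [Fintype ι] :
    iIndepFun (fun (i : ι) (x : ι → ℝ) => x i) (stdPi ι) :=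
  iIndepFun_pi (X := fun (_ : ι) (x : ℝ) => x) fun _ => aemeasurable_id

lemma hasLaw_eval_stdPi {ι : Type*} [Fintype ι] (i : ι) :
    HasLaw (fun x : ι → ℝ => x i) (gaussianReal 0 1) (stdPi ι) :=
  (measurePreserving_eval (fun _ : ι => gaussianReal 0 1) i).hasLaw

lemma hasLaw_precomp_stdPi {ι α : Type*} [Fintype ι] [Fintype α] {g : α → ι}
    (hg : Function.Injective g) :
    HasLaw (fun (x : ι → ℝ) a => x (g a)) (stdPi α) (stdPi ι) :=
  ((iIndepFun_stdPi ι).precomp hg).hasLaw_pi fun a => hasLaw_eval_stdPi (g a)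

variable {p n : ℕ}

/-- The matrix with the entries `x`. -/
def toMat (x : Fin p × Fin n → ℝ) : Matrix (Fin p) (Fin n) ℝ :=
  Matrix.of fun k j => x (k, j)

@[fun_prop]
lemma continuous_toMat : Continuous (toMat : (Fin p × Fin n → ℝ) → Matrix (Fin p) (Fin n) ℝ) :=
  continuous_matrix fun k j => continuous_apply (k, j)

lemma measurable_det_gram : Measurable fun x : Fin p × Fin n → ℝ =>
    ((toMat x)ᵀ * toMat x).det :=
  (Continuous.matrix_det (by fun_prop)).measurable

lemma measurable_inv_gram (i j : Fin n) : Measurable fun x : Fin p × Fin n → ℝ =>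
    ((toMat x)ᵀ * toMat x)⁻¹ i j := by
  -- This also holds for a singular Gram matrix, where both sides are `0` by convention.
  have h : ∀ x : Fin p × Fin n → ℝ, ((toMat x)ᵀ * toMat x)⁻¹ i j =
      (((toMat x)ᵀ * toMat x).det)⁻¹ * ((toMat x)ᵀ * toMat x).adjugate i j := by
    intro x
    rw [Matrix.inv_def, Ring.inverse_eq_inv', Matrix.smul_apply, smul_eq_mul]
  simp_rw [h]
  refine measurable_det_gram.inv.mul (Continuous.measurable ?_)
  exact (Continuous.matrix_adjugate (by fun_prop)).matrix_elem i j

lemma measurable_pinv (k : Fin p) (j : Fin n) : Measurable fun x : Fin p × Fin n → ℝ =>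
    pinv (toMat x) k j := by
  simp only [pinv, Matrix.mul_apply (M := toMat _)]
  exact Finset.measurable_fun_sum _ fun i _ => (measurable_pi_apply (k, i)).mul
    (measurable_inv_gram i j)

lemma measurable_hat (i j : Fin p) : Measurable fun x : Fin p × Fin n → ℝ =>
    hat (toMat x) i j := by
  simp only [hat, Matrix.mul_apply (M := pinv _)]
  exact Finset.measurable_fun_sum _ fun k _ => (measurable_pinv i k).mul
    (measurable_pi_apply (j, k))

/-- The other columns and the column `j`. -/
def splitCol (j : Fin (n + 1)) (x : Fin p × Fin (n + 1) → ℝ) :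
    (Fin p × Fin n → ℝ) × (Fin p → ℝ) :=
  (fun a => x (a.1, j.succAbove a.2), fun k => x (k, j))

/-- The inverse of `splitCol j`. -/
def joinCol (j : Fin (n + 1)) (y : (Fin p × Fin n → ℝ) × (Fin p → ℝ)) :
    Fin p × Fin (n + 1) → ℝ :=
  fun a => j.insertNth (α := fun _ => ℝ) (y.2 a.1) (fun i => y.1 (a.1, i)) a.2

lemma joinCol_splitCol (j : Fin (n + 1)) (x : Fin p × Fin (n + 1) → ℝ) :
    joinCol j (splitCol j x) = x := by
  ext ⟨k, i⟩
  rcases eq_or_ne i j with rfl | hij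
  · simp [joinCol, splitCol]
  · obtain ⟨i, rfl⟩ := Fin.exists_succAbove_eq hij
    simp [joinCol, splitCol]

lemma measurable_joinCol (j : Fin (n + 1)) :
    Measurable (joinCol j : (Fin p × Fin n → ℝ) × (Fin p → ℝ) → Fin p × Fin (n + 1) → ℝ) := by
  refine measurable_pi_lambda _ fun a => ?_
  obtain ⟨k, i⟩ := a
  rcases eq_or_ne i j with rfl | hij
  · simp only [joinCol, Fin.insertNth_apply_same]
    fun_prop
  · obtain ⟨i, rfl⟩ := Fin.exists_succAbove_eq hij
    simp only [joinCol, Fin.insertNth_apply_succAbove]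
    fun_prop

lemma hasLaw_splitCol (j : Fin (n + 1)) :
    HasLaw (splitCol j) ((stdPi (Fin p × Fin n)).prod (stdPi (Fin p)))
      (stdPi (Fin p × Fin (n + 1))) := by
  refine IndepFun.hasLaw_prod (hasLaw_precomp_stdPi ?_) (hasLaw_precomp_stdPi ?_)
    (indepFun_precomp (iIndepFun_stdPi _) (fun i => (measurable_pi_apply i).aemeasurable)
      (fun a : Fin p × Fin n => (a.1, j.succAbove a.2)) (fun k : Fin p => (k, j)) ?_)
  · rintro ⟨a, b⟩ ⟨c, d⟩ h
    simpa using h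
  · intro a b h
    simpa using h
  · rintro ⟨a, b⟩ c h
    exact j.succAbove_ne b (Prod.ext_iff.1 h).2

lemma toMat_joinCol_submatrix (j : Fin (n + 1)) (y : (Fin p × Fin n → ℝ) × (Fin p → ℝ)) :
    (toMat (joinCol j y)).submatrix id j.succAbove = toMat y.1 := by
  ext k i
  simp [toMat, joinCol]

lemma toMat_joinCol_col (j : Fin (n + 1)) (y : (Fin p × Fin n → ℝ) × (Fin p → ℝ)) :
    (toMat (joinCol j y)).col j = y.2 := by
  ext k
  simp [toMat, joinCol]

/-- The complement has dimension `p - n ≥ 3`, as the inverse chi-square mean requires. `Y` stands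
for a matrix with one column removed, so `n + 3 ≤ p` is the original bound shifted by one. -/
lemma lintegral_inv_norm_proj_colOrth {Y : Matrix (Fin p) (Fin n) ℝ} (hY : IsUnit (Yᵀ * Y).det)
    (hpn : n + 3 ≤ p) :
    ∫⁻ c, (ENNReal.ofReal (‖(colOrth Y).orthogonalProjectionOnto (WithLp.toLp 2 c)‖ ^ 2))⁻¹
      ∂(stdPi (Fin p)) = ENNReal.ofReal (1 / ((p : ℝ) - n - 2)) := by
  have hk := finrank_colOrth hY
  have h := lintegral_inv_norm_orthogonalProjection_sq (colOrth Y) (by omega)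
  rw [← map_pi_eq_stdGaussian, lintegral_map (by fun_prop) (by fun_prop)] at h
  rw [h]
  congr 3
  have : (p : ℝ) = Module.finrank ℝ (colOrth Y) + n := by exact_mod_cast hk.symm
  rw [this]
  ring

/-- The inverse squared norm has finite mean, whereas it is `∞` wherever the projection vanishes. -/
lemma ae_proj_colOrth_ne_zero {Y : Matrix (Fin p) (Fin n) ℝ} (hY : IsUnit (Yᵀ * Y).det)
    (hpn : n + 3 ≤ p) :
    ∀ᵐ c ∂(stdPi (Fin p)), (colOrth Y).orthogonalProjectionOnto (WithLp.toLp 2 c) ≠ 0 := by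
  have h := ae_lt_top (μ := stdPi (Fin p)) (f := fun c =>
    (ENNReal.ofReal (‖(colOrth Y).orthogonalProjectionOnto (WithLp.toLp 2 c)‖ ^ 2))⁻¹)
    (by fun_prop) (by rw [lintegral_inv_norm_proj_colOrth hY hpn]; exact ENNReal.ofReal_ne_top)
  filter_upwards [h] with c hc h0
  simp [h0] at hc

/-- A standard Gaussian matrix with `n + 2 ≤ p` has full column rank almost surely. -/
lemma ae_isUnit_det_gram (hpn : n + 2 ≤ p) :
    ∀ᵐ x ∂(stdPi (Fin p × Fin n)), IsUnit ((toMat x)ᵀ * toMat x).det := by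
  induction n with
  | zero => exact ae_of_all _ fun x => by simp
  | succ n ih =>
    have hms : MeasurableSet {y : (Fin p × Fin n → ℝ) × (Fin p → ℝ) |
        IsUnit ((toMat (joinCol 0 y))ᵀ * toMat (joinCol 0 y)).det} := by
      simp only [isUnit_iff_ne_zero]
      exact (measurable_det_gram.comp (measurable_joinCol 0)) (measurableSet_singleton 0).compl
    have h1 : ∀ᵐ y ∂((stdPi (Fin p × Fin n)).prod (stdPi (Fin p))),
        IsUnit ((toMat (joinCol 0 y))ᵀ * toMat (joinCol 0 y)).det := by
      rw [Measure.ae_prod_iff_ae_ae hms]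
      -- With the other columns fixed and independent, the new Gaussian column almost surely avoids
      -- their span.
      filter_upwards [ih (by omega)] with y hy
      filter_upwards [ae_proj_colOrth_ne_zero hy (by omega)] with c hc
      refine (inv_gram_diag 0 ?_ ?_).1
      · rwa [toMat_joinCol_submatrix]
      · rwa [toMat_joinCol_submatrix, toMat_joinCol_col]
    rw [← (hasLaw_splitCol 0).map_eq] at h1
    filter_upwards [ae_of_ae_map (hasLaw_splitCol 0).aemeasurable h1] with x hx
    rwa [joinCol_splitCol] at hx

lemma lintegral_inv_gram_diag (j : Fin n) (hpn : n + 2 ≤ p) :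
    ∫⁻ x, ENNReal.ofReal (((toMat x)ᵀ * toMat x)⁻¹ j j) ∂(stdPi (Fin p × Fin n)) =
      ENNReal.ofReal (1 / ((p : ℝ) - n - 1)) := by
  obtain _ | n := n
  · exact j.elim0
  have hm := measurable_inv_gram (p := p) j j
  have hm' : Measurable fun y : (Fin p × Fin n → ℝ) × (Fin p → ℝ) =>
      ENNReal.ofReal (((toMat (joinCol j y))ᵀ * toMat (joinCol j y))⁻¹ j j) :=
    (hm.comp (measurable_joinCol j)).ennreal_ofReal
  have h1 := (hasLaw_splitCol (p := p) j).lintegral_comp hm'.aemeasurable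
  simp only [joinCol_splitCol] at h1
  rw [h1, lintegral_prod _ hm'.aemeasurable]
  have h2 : ∀ᵐ y ∂(stdPi (Fin p × Fin n)), ∫⁻ c, ENNReal.ofReal
      (((toMat (joinCol j (y, c)))ᵀ * toMat (joinCol j (y, c)))⁻¹ j j) ∂(stdPi (Fin p)) =
      ENNReal.ofReal (1 / ((p : ℝ) - (n + 1 : ℕ) - 1)) := by
    filter_upwards [ae_isUnit_det_gram (p := p) (n := n) (by omega)] with y hy
    -- The matrix has `n + 1` columns, and the `n` others leave `p - n` degrees of freedom.
    have h3 : (p : ℝ) - (n + 1 : ℕ) - 1 = p - n - 2 := by push_cast; ring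
    rw [h3, ← lintegral_inv_norm_proj_colOrth hy (by omega)]
    refine lintegral_congr_ae ?_
    filter_upwards [ae_proj_colOrth_ne_zero hy (by omega)] with c hc
    have h4 := (inv_gram_diag (X := toMat (joinCol j (y, c))) j
      (by rwa [toMat_joinCol_submatrix])
      (by rwa [toMat_joinCol_submatrix, toMat_joinCol_col])).2
    rw [h4, toMat_joinCol_submatrix, toMat_joinCol_col, ENNReal.ofReal_inv_of_pos]
    exact pow_pos (norm_pos_iff.2 hc) 2
  rw [lintegral_congr_ae h2]
  simp

/-- The expected diagonal entries of the inverse of a Wishart matrix. -/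
lemma integrable_inv_gram_diag (j : Fin n) (hpn : n + 2 ≤ p) :
    Integrable (fun x => ((toMat x)ᵀ * toMat x)⁻¹ j j) (stdPi (Fin p × Fin n)) ∧
      ∫ x, ((toMat x)ᵀ * toMat x)⁻¹ j j ∂(stdPi (Fin p × Fin n)) = 1 / ((p : ℝ) - n - 1) := by
  have hm := (measurable_inv_gram (p := p) j j).aestronglyMeasurable
    (μ := stdPi (Fin p × Fin n))
  have h0 : 0 ≤ᵐ[stdPi (Fin p × Fin n)] fun x => ((toMat x)ᵀ * toMat x)⁻¹ j j := by
    filter_upwards [ae_isUnit_det_gram hpn] with x hx using inv_gram_diag_nonneg hx j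
  constructor
  · rw [← lintegral_ofReal_ne_top_iff_integrable hm h0, lintegral_inv_gram_diag j hpn]
    exact ENNReal.ofReal_ne_top
  · have : (n : ℝ) + 2 ≤ p := by exact_mod_cast hpn
    rw [integral_eq_lintegral_of_nonneg_ae h0 hm, lintegral_inv_gram_diag j hpn,
      ENNReal.toReal_ofReal (one_div_nonneg.2 (by linarith))]

lemma integrable_inv_gram (i j : Fin n) (hpn : n + 2 ≤ p) :
    Integrable (fun x => ((toMat x)ᵀ * toMat x)⁻¹ i j) (stdPi (Fin p × Fin n)) := by
  refine Integrable.mono' (((integrable_inv_gram_diag i hpn).1.add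
    (integrable_inv_gram_diag j hpn).1).div_const 2) (measurable_inv_gram i j).aestronglyMeasurable
    ?_
  filter_upwards [ae_isUnit_det_gram hpn] with x hx using abs_inv_gram_le hx i j

lemma integrable_pinv (k : Fin p) (j : Fin n) (hpn : n + 2 ≤ p) :
    Integrable (fun x => pinv (toMat x) k j) (stdPi (Fin p × Fin n)) := by
  refine Integrable.mono' ((integrable_inv_gram_diag j hpn).1.add (integrable_const 1))
    (measurable_pinv k j).aestronglyMeasurable ?_
  filter_upwards [ae_isUnit_det_gram hpn] with x hx
  have := pinv_sq_le hx k j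
  simp only [Pi.add_apply]
  rw [Real.norm_eq_abs]
  -- `|a| ≤ a² + 1`.
  nlinarith [sq_abs (pinv (toMat x) k j), sq_nonneg (|pinv (toMat x) k j| - 1)]

lemma integrable_hat (i j : Fin p) (hpn : n + 2 ≤ p) :
    Integrable (fun x => hat (toMat x) i j) (stdPi (Fin p × Fin n)) := by
  refine Integrable.of_bound (measurable_hat i j).aestronglyMeasurable 1 ?_
  filter_upwards [ae_isUnit_det_gram hpn] with x hx using abs_hat_le hx i j

lemma hat_mul_of_transpose_mul_self (X : Matrix (Fin p) (Fin n) ℝ) {D : Matrix (Fin p) (Fin p) ℝ}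
    (hD : Dᵀ * D = 1) : hat (D * X) = D * hat X * Dᵀ := by
  have h : (D * X)ᵀ * (D * X) = Xᵀ * X := by
    rw [Matrix.transpose_mul, Matrix.mul_assoc, ← Matrix.mul_assoc Dᵀ, hD, Matrix.one_mul]
  rw [hat, pinv, h, hat, pinv, Matrix.transpose_mul]
  simp only [Matrix.mul_assoc]

lemma hat_submatrix (X : Matrix (Fin p) (Fin n) ℝ) (e : Fin p ≃ Fin p) :
    hat (X.submatrix e id) = (hat X).submatrix e e := by
  have h : (X.submatrix e id)ᵀ * X.submatrix e id = Xᵀ * X := by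
    rw [Matrix.transpose_submatrix, Matrix.submatrix_mul_equiv, Matrix.submatrix_id_id]
  rw [hat, pinv, h, hat, pinv]
  ext a b
  simp [Matrix.mul_apply]

/-- Flipping the sign of row `i` preserves the Gaussian law and negates `H i j`. -/
lemma integral_hat_off_diag {i j : Fin p} (hij : i ≠ j) :
    ∫ x, hat (toMat x) i j ∂(stdPi (Fin p × Fin n)) = 0 := by
  let s : Fin p → ℝ := fun k => if k = i then -1 else 1
  have hs : ∀ k, s k * s k = 1 := fun k => by by_cases h : k = i <;> simp [s, h]
  have hT : MeasurePreserving (fun (x : Fin p × Fin n → ℝ) a => s a.1 * x a)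
      (stdPi (Fin p × Fin n)) (stdPi (Fin p × Fin n)) := by
    refine measurePreserving_pi _ _ (f := fun (a : Fin p × Fin n) (x : ℝ) => s a.1 * x)
      fun a => ⟨by fun_prop, ?_⟩
    rw [gaussianReal_map_const_mul]
    congr 1
    · simp
    · ext
      simp [sq, hs]
  have h1 : ∀ x : Fin p × Fin n → ℝ,
      hat (toMat fun a : Fin p × Fin n => s a.1 * x a) i j = -hat (toMat x) i j := by
    intro x
    have h2 : toMat (fun a : Fin p × Fin n => s a.1 * x a) = Matrix.diagonal s * toMat x := by
      ext k l
      simp [toMat]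
    rw [h2, hat_mul_of_transpose_mul_self]
    · simp [s, hij.symm]
    · simp [hs]
  have h3 := hT.hasLaw.integral_comp (f := fun x => hat (toMat x) i j)
    (measurable_hat i j).aestronglyMeasurable
  simp only [Function.comp_def, h1, integral_neg] at h3
  linarith

/-- Swapping rows `i` and `j` preserves the law and exchanges the two diagonal entries. -/
lemma integral_hat_diag_eq (i j : Fin p) :
    ∫ x, hat (toMat x) i i ∂(stdPi (Fin p × Fin n)) =
      ∫ x, hat (toMat x) j j ∂(stdPi (Fin p × Fin n)) := by
  have hT := hasLaw_precomp_stdPi (ι := Fin p × Fin n)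
    (g := Prod.map (Equiv.swap i j) id)
    ((Equiv.swap i j).injective.prodMap Function.injective_id)
  have h3 := hT.integral_comp (f := fun x => hat (toMat x) i i)
    (measurable_hat i i).aestronglyMeasurable
  rw [← h3]
  have h2 : ∀ x : Fin p × Fin n → ℝ, toMat (fun a => x (Prod.map (Equiv.swap i j) id a)) =
      (toMat x).submatrix (Equiv.swap i j) id := fun x => rfl
  simp only [Function.comp_def, h2, hat_submatrix, Matrix.submatrix_apply, Equiv.swap_apply_left]

/-- The expected projection onto the column space of a standard Gaussian matrix. -/
lemma integral_hat (hpn : n + 2 ≤ p) (i j : Fin p) :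
    ∫ x, hat (toMat x) i j ∂(stdPi (Fin p × Fin n)) = if i = j then (n : ℝ) / p else 0 := by
  split_ifs with hij
  · subst hij
    have h1 : ∫ x, (hat (toMat x)).trace ∂(stdPi (Fin p × Fin n)) = n := by
      rw [integral_congr_ae (g := fun _ => (n : ℝ))]
      · simp
      · filter_upwards [ae_isUnit_det_gram hpn] with x hx using trace_hat hx
    simp only [Matrix.trace, Matrix.diag_apply] at h1
    rw [integral_finsetSum _ fun k _ => integrable_hat k k hpn] at h1
    simp only [integral_hat_diag_eq _ i, Finset.sum_const, Finset.card_univ, Fintype.card_fin,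
      nsmul_eq_mul] at h1
    rw [← h1]
    have : (p : ℝ) ≠ 0 := by
      have : 0 < p := by omega
      positivity
    field_simp
  · exact integral_hat_off_diag hij

end GaussianMatrix

/-! ### The expected squared error after one training step. -/

section OneStep

variable {Ω : Type*} [MeasurableSpace Ω] {μ : Measure Ω} {p n : ℕ}

lemma integrable_comp_of_hasLaw {𝓧 : Type*} [MeasurableSpace 𝓧] {ν : Measure 𝓧} {x : Ω → 𝓧}
    (hx : HasLaw x ν μ) {f : 𝓧 → ℝ} (hf : Integrable f ν) :
    Integrable (fun ω => f (x ω)) μ ∧ ∫ ω, f (x ω) ∂μ = ∫ y, f y ∂ν := by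
  refine ⟨?_, hx.integral_comp hf.aestronglyMeasurable⟩
  rw [← hx.map_eq] at hf
  exact hf.comp_aemeasurable hx.aemeasurable

lemma integral_double_sum {α β : Type*} [Fintype α] [Fintype β] {F : α → β → Ω → ℝ}
    (hF : ∀ i j, Integrable (F i j) μ) :
    Integrable (fun ω => ∑ i, ∑ j, F i j ω) μ ∧
      ∫ ω, ∑ i, ∑ j, F i j ω ∂μ = ∑ i, ∑ j, ∫ ω, F i j ω ∂μ := by
  have h1 : ∀ i, Integrable (fun ω => ∑ j, F i j ω) μ := fun i =>
    integrable_finsetSum _ fun j _ => hF i j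
  refine ⟨integrable_finsetSum _ fun i _ => h1 i, ?_⟩
  rw [integral_finsetSum _ fun i _ => h1 i]
  exact Finset.sum_congr rfl fun i _ => integral_finsetSum _ fun j _ => hF i j

lemma dotProduct_mulVec_eq_sum {m k : Type*} [Fintype m] [Fintype k] (x : m → ℝ)
    (B : Matrix m k ℝ) (y : k → ℝ) : x ⬝ᵥ (B *ᵥ y) = ∑ i, ∑ j, x i * y j * B i j := by
  simp only [Matrix.mulVec, dotProduct, Finset.mul_sum]
  exact Finset.sum_congr rfl fun i _ => Finset.sum_congr rfl fun j _ => by ring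

/-- Moments of a vector of independent centred Gaussian variables. -/
lemma integral_gaussian_moments {s : ℝ≥0} {z : Ω → Fin n → ℝ}
    (hz : HasLaw z (Measure.pi fun _ => gaussianReal 0 s) μ) :
    (∀ i, Integrable (fun ω => z ω i) μ ∧ ∫ ω, z ω i ∂μ = 0) ∧
      ∀ i j, Integrable (fun ω => z ω i * z ω j) μ ∧
        ∫ ω, z ω i * z ω j ∂μ = if i = j then (s : ℝ) else 0 := by
  have h1 : ∀ i, HasLaw (fun ω => z ω i) (gaussianReal 0 s) μ := fun i =>
    (measurePreserving_eval (fun _ : Fin n => gaussianReal 0 s) i).hasLaw.comp hz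
  have := hz.isProbabilityMeasure
  have hind : iIndepFun (fun i ω => z ω i) μ := (iIndepFun_iff_hasLaw_pi_pi h1).2 hz
  have hL : ∀ i, MemLp (fun ω => z ω i) 2 μ := by
    intro i
    have h2 := memLp_id_gaussianReal (μ := 0) (v := s) 2
    rw [← (h1 i).map_eq] at h2
    exact h2.comp_of_map (h1 i).aemeasurable
  have h0 : ∀ i, ∫ ω, z ω i ∂μ = 0 := fun i => by
    rw [(h1 i).integral_eq, integral_id_gaussianReal]
  refine ⟨fun i => ⟨(hL i).integrable one_le_two, h0 i⟩, fun i j => ⟨(hL i).integrable_mul (hL j),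
    ?_⟩⟩
  split_ifs with hij
  · subst hij
    have h3 := (h1 i).variance_eq
    rw [variance_id_gaussianReal, variance_of_integral_eq_zero (h1 i).aemeasurable (h0 i)] at h3
    simpa [sq] using h3
  · rw [(hind.indepFun hij).integral_fun_mul_eq_mul_integral (hL i).aestronglyMeasurable
      (hL j).aestronglyMeasurable, h0, zero_mul]

/-- The expected squared distance from `u` after one training step from a random point `v` that
is independent of the training data. -/
lemma integral_step (hpn : n + 2 ≤ p) {s : ℝ≥0} {x : Ω → Fin p × Fin n → ℝ}
    {z : Ω → Fin n → ℝ} {v : Ω → Fin p → ℝ} (hx : HasLaw x (stdPi (Fin p × Fin n)) μ)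
    (hz : HasLaw z (Measure.pi fun _ => gaussianReal 0 s) μ) (hxz : IndepFun x z μ)
    (hvL : ∀ k, MemLp (fun ω => v ω k) 2 μ) (hv : IndepFun v x μ) (a u : Fin p → ℝ) :
    Integrable (fun ω => (step (toMat (x ω)) ((toMat (x ω))ᵀ *ᵥ a + z ω) (v ω) - u) ⬝ᵥ
        (step (toMat (x ω)) ((toMat (x ω))ᵀ *ᵥ a + z ω) (v ω) - u)) μ ∧
      ∫ ω, (step (toMat (x ω)) ((toMat (x ω))ᵀ *ᵥ a + z ω) (v ω) - u) ⬝ᵥ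
          (step (toMat (x ω)) ((toMat (x ω))ᵀ *ᵥ a + z ω) (v ω) - u) ∂μ =
        (1 - n / p) * ∫ ω, (v ω - u) ⬝ᵥ (v ω - u) ∂μ + n / p * ((a - u) ⬝ᵥ (a - u)) +
          s * (n / ((p : ℝ) - n - 1)) := by
  have := hx.isProbabilityMeasure
  have hunit : ∀ᵐ ω ∂μ, IsUnit ((toMat (x ω))ᵀ * toMat (x ω)).det := by
    have := ae_isUnit_det_gram hpn
    rw [← hx.map_eq] at this
    exact ae_of_ae_map hx.aemeasurable this
  have hH := fun i j => integrable_comp_of_hasLaw hx (integrable_hat (n := n) i j hpn)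
  simp only [integral_hat hpn] at hH
  have hA := fun i j => integrable_comp_of_hasLaw hx (integrable_pinv (p := p) (n := n) i j hpn)
  have hM := fun i j => integrable_comp_of_hasLaw hx (integrable_inv_gram (p := p) i j hpn)
  have hMd : ∀ j : Fin n, ∫ ω, ((toMat (x ω))ᵀ * toMat (x ω))⁻¹ j j ∂μ = 1 / ((p : ℝ) - n - 1) :=
    fun j => (hM j j).2.trans (integrable_inv_gram_diag j hpn).2
  obtain ⟨hz1, hz2⟩ := integral_gaussian_moments hz
  have hvu : ∀ k, MemLp (fun ω => v ω k - u k) 2 μ := fun k => (hvL k).sub (memLp_const _)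
  have hvv : ∀ i j, Integrable (fun ω => (v ω i - u i) * (v ω j - u j)) μ := fun i j =>
    (hvu i).integrable_mul (hvu j)
  have h1 : Integrable (fun ω => (v ω - u) ⬝ᵥ (v ω - u)) μ :=
    integrable_finsetSum _ fun k _ => hvv k k
  have hvH : ∀ i j, IndepFun (fun ω => (v ω i - u i) * (v ω j - u j))
      (fun ω => hat (toMat (x ω)) i j) μ := fun i j =>
    hv.comp (φ := fun y : Fin p → ℝ => (y i - u i) * (y j - u j)) (by fun_prop) (measurable_hat i j)
  -- Independence factors each entry, and `E H = (n/p) I` leaves only `i = j`.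
  have h2 : Integrable (fun ω => (v ω - u) ⬝ᵥ (hat (toMat (x ω)) *ᵥ (v ω - u))) μ ∧
      ∫ ω, (v ω - u) ⬝ᵥ (hat (toMat (x ω)) *ᵥ (v ω - u)) ∂μ =
        n / p * ∫ ω, (v ω - u) ⬝ᵥ (v ω - u) ∂μ := by
    simp only [dotProduct_mulVec_eq_sum, Pi.sub_apply]
    have h := integral_double_sum fun i j => (hvH i j).integrable_mul (hvv i j) (hH i j).1
    refine ⟨h.1, h.2.trans ?_⟩
    have h' : ∀ i j, ∫ ω, ((fun ω => (v ω i - u i) * (v ω j - u j)) *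
        fun ω => hat (toMat (x ω)) i j) ω ∂μ =
        (∫ ω, (v ω i - u i) * (v ω j - u j) ∂μ) * if i = j then (n : ℝ) / p else 0 := by
      intro i j
      rw [(hvH i j).integral_mul_eq_mul_integral (hvv i j).aestronglyMeasurable
        (hH i j).1.aestronglyMeasurable, (hH i j).2]
    simp only [h', mul_ite, mul_zero, Finset.sum_ite_eq, Finset.mem_univ, if_true, dotProduct,
      Pi.sub_apply]
    rw [integral_finsetSum _ fun k _ => hvv k k, Finset.mul_sum]
    exact Finset.sum_congr rfl fun k _ => mul_comm _ _
  have h3 : Integrable (fun ω => (a - u) ⬝ᵥ (hat (toMat (x ω)) *ᵥ (a - u))) μ ∧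
      ∫ ω, (a - u) ⬝ᵥ (hat (toMat (x ω)) *ᵥ (a - u)) ∂μ = n / p * ((a - u) ⬝ᵥ (a - u)) := by
    simp only [dotProduct_mulVec_eq_sum]
    have h := integral_double_sum fun i j => (hH i j).1.const_mul ((a - u) i * (a - u) j)
    refine ⟨h.1, h.2.trans ?_⟩
    simp only [integral_const_mul, hH, mul_ite, mul_zero, Finset.sum_ite_eq, Finset.mem_univ,
      if_true, dotProduct]
    rw [← Finset.sum_mul, mul_comm]
  -- The cross term has mean zero because `z` is centred and independent of `X`.
  have h4 : Integrable (fun ω => (a - u) ⬝ᵥ (pinv (toMat (x ω)) *ᵥ z ω)) μ ∧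
      ∫ ω, (a - u) ⬝ᵥ (pinv (toMat (x ω)) *ᵥ z ω) ∂μ = 0 := by
    simp only [dotProduct_mulVec_eq_sum, mul_assoc]
    have hi : ∀ i j, IndepFun (fun ω => z ω j) (fun ω => pinv (toMat (x ω)) i j) μ := fun i j =>
      hxz.symm.comp (measurable_pi_apply j) (measurable_pinv i j)
    have h := integral_double_sum fun i j =>
      ((hi i j).integrable_mul (hz1 j).1 (hA i j).1).const_mul ((a - u) i)
    refine ⟨h.1, h.2.trans ?_⟩
    refine Finset.sum_eq_zero fun i _ => Finset.sum_eq_zero fun j _ => ?_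
    rw [integral_const_mul, (hi i j).integral_mul_eq_mul_integral (hz1 j).1.aestronglyMeasurable
      (hA i j).1.aestronglyMeasurable, (hz1 j).2, zero_mul, mul_zero]
  -- Uncorrelated noise leaves `s` times the trace of `E G⁻¹`, a sum of `n` equal entries.
  have h5 : Integrable (fun ω => z ω ⬝ᵥ (((toMat (x ω))ᵀ * toMat (x ω))⁻¹ *ᵥ z ω)) μ ∧
      ∫ ω, z ω ⬝ᵥ (((toMat (x ω))ᵀ * toMat (x ω))⁻¹ *ᵥ z ω) ∂μ =
        s * (n / ((p : ℝ) - n - 1)) := by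
    simp only [dotProduct_mulVec_eq_sum]
    have hi : ∀ i j, IndepFun (fun ω => z ω i * z ω j)
        (fun ω => ((toMat (x ω))ᵀ * toMat (x ω))⁻¹ i j) μ := fun i j =>
      hxz.symm.comp (φ := fun y : Fin n → ℝ => y i * y j) (by fun_prop) (measurable_inv_gram i j)
    have h := integral_double_sum fun i j => (hi i j).integrable_mul (hz2 i j).1 (hM i j).1
    refine ⟨h.1, h.2.trans ?_⟩
    have h' : ∀ i j, ∫ ω, ((fun ω => z ω i * z ω j) *
        fun ω => ((toMat (x ω))ᵀ * toMat (x ω))⁻¹ i j) ω ∂μ =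
        if i = j then (s : ℝ) * (1 / ((p : ℝ) - n - 1)) else 0 := by
      intro i j
      rw [(hi i j).integral_mul_eq_mul_integral (hz2 i j).1.aestronglyMeasurable
        (hM i j).1.aestronglyMeasurable, (hz2 i j).2]
      split_ifs with hij
      · subst hij
        rw [hMd]
      · rw [zero_mul]
    simp only [h', Finset.sum_ite_eq, Finset.mem_univ, if_true, Finset.sum_const,
      Finset.card_univ, Fintype.card_fin, nsmul_eq_mul]
    ring
  have h6 := (((h1.sub h2.1).add h3.1).add (h4.1.const_mul 2)).add h5.1
  have h7 := hunit.mono fun ω hω => step_sub_dotProduct_self hω a u (v ω) (z ω)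
  refine ⟨h6.congr (h7.mono fun ω hω => hω.symm), ?_⟩
  refine (integral_congr_ae h7).trans ((integral_add (((h1.sub h2.1).add h3.1).add
    (h4.1.const_mul 2)) h5.1).trans ?_)
  rw [integral_add' ((h1.sub h2.1).add h3.1) (h4.1.const_mul 2), integral_add' (h1.sub h2.1) h3.1,
    integral_sub' h1 h2.1, integral_const_mul, h2.2, h3.2, h4.2, h5.2]
  ring

/-- Provides the square integrability that `integral_step` asks of its starting point. -/
lemma memLp_of_integrable_dotProduct_self {w : Ω → Fin p → ℝ} (hw : AEMeasurable w μ)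
    (h : Integrable (fun ω => w ω ⬝ᵥ w ω) μ) (k : Fin p) : MemLp (fun ω => w ω k) 2 μ := by
  have hm : AEStronglyMeasurable (fun ω => w ω k) μ := by fun_prop
  rw [memLp_two_iff_integrable_sq hm]
  refine Integrable.mono' h (by fun_prop) (ae_of_all _ fun ω => ?_)
  rw [Real.norm_eq_abs, abs_of_nonneg (sq_nonneg _), sq]
  exact Finset.single_le_sum (f := fun k => w ω k * w ω k)
    (fun k _ => mul_self_nonneg (w ω k)) (Finset.mem_univ k)

lemma measurable_step (a v : Fin p → ℝ) :
    Measurable fun y : (Fin p × Fin n → ℝ) × (Fin n → ℝ) =>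
      step (toMat y.1) ((toMat y.1)ᵀ *ᵥ a + y.2) v := by
  refine measurable_pi_lambda _ fun k => ?_
  simp only [step, Pi.add_apply, Matrix.mulVec, dotProduct, Pi.sub_apply, Matrix.transpose_apply,
    toMat, Matrix.of_apply]
  refine measurable_const.add (Finset.measurable_fun_sum _ fun j _ => ?_)
  refine Measurable.mul ((measurable_pinv k j).comp measurable_fst) ?_
  fun_prop

end OneStep

/-! ### Laws and independence of the data blocks. -/

section Data

variable {Ω : Type*} [MeasurableSpace Ω] {μ : Measure Ω} {T p n : ℕ} {σ : ℝ}
  {X : Fin T → Ω → Matrix (Fin p) (Fin n) ℝ} {z : Fin T → Ω → Fin n → ℝ}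

/-- The entries of the matrix `X t ω`. -/
def entries (X : Fin T → Ω → Matrix (Fin p) (Fin n) ℝ) (t : Fin T) (ω : Ω) :
    Fin p × Fin n → ℝ :=
  fun a => X t ω a.1 a.2

/-- All entries of the data as one family. -/
def dataFamily (X : Fin T → Ω → Matrix (Fin p) (Fin n) ℝ) (z : Fin T → Ω → Fin n → ℝ)
    (s : (Fin T × Fin p × Fin n) ⊕ (Fin T × Fin n)) (ω : Ω) : ℝ :=
  Sum.elim (fun a => X a.1 ω a.2.1 a.2.2) (fun b => z b.1 ω b.2) s

namespace IsGaussianData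

lemma iIndepFun_dataFamily (h : IsGaussianData μ σ X z) : iIndepFun (dataFamily X z) μ :=
  h.indep

lemma aemeasurable_dataFamily (h : IsGaussianData μ σ X z)
    (s : (Fin T × Fin p × Fin n) ⊕ (Fin T × Fin n)) : AEMeasurable (dataFamily X z s) μ := by
  obtain ⟨t, k, j⟩ | ⟨t, j⟩ := s
  · exact (h.features_law t k j).aemeasurable
  · exact (h.noise_law t j).aemeasurable

lemma hasLaw_entries (h : IsGaussianData μ σ X z) (t : Fin T) :
    HasLaw (entries X t) (stdPi (Fin p × Fin n)) μ := by
  have h1 : iIndepFun (fun (a : Fin p × Fin n) ω => X t ω a.1 a.2) μ :=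
    h.iIndepFun_dataFamily.precomp (g := fun a : Fin p × Fin n => Sum.inl (t, a))
      fun a b hab => by simpa using hab
  exact h1.hasLaw_pi fun a => h.features_law t a.1 a.2

lemma hasLaw_noise (h : IsGaussianData μ σ X z) (t : Fin T) :
    HasLaw (z t) (Measure.pi fun _ => gaussianReal 0 (σ ^ 2).toNNReal) μ := by
  have h1 : iIndepFun (fun (j : Fin n) ω => z t ω j) μ :=
    h.iIndepFun_dataFamily.precomp (g := fun j : Fin n => Sum.inr (t, j))
      fun a b hab => by simpa using hab
  exact h1.hasLaw_pi fun j => h.noise_law t j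

lemma indepFun_entries_noise (h : IsGaussianData μ σ X z) (t : Fin T) :
    IndepFun (entries X t) (z t) μ :=
  indepFun_precomp h.iIndepFun_dataFamily h.aemeasurable_dataFamily
    (fun a : Fin p × Fin n => Sum.inl (t, a)) (fun j : Fin n => Sum.inr (t, j)) (by simp)

/-- The data of one task are independent of the features of another one. -/
lemma indepFun_tasks (h : IsGaussianData μ σ X z) {t t' : Fin T} (ht : t ≠ t') :
    IndepFun (fun ω => (entries X t ω, z t ω)) (entries X t') μ := by
  -- Features and noise of task `t` are first packed into one block over a sum type, and unpacked by
  -- `h2`.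
  have h1 : IndepFun (fun ω (b : (Fin p × Fin n) ⊕ Fin n) =>
      dataFamily X z (Sum.map (fun a => (t, a)) (fun j => (t, j)) b) ω) (entries X t') μ :=
    indepFun_precomp h.iIndepFun_dataFamily h.aemeasurable_dataFamily
      (fun b : (Fin p × Fin n) ⊕ Fin n => Sum.map (fun a => (t, a)) (fun j => (t, j)) b)
      (fun a : Fin p × Fin n => Sum.inl (t', a)) (by rintro (a | j) b <;> simp [ht])
  have h2 : Measurable fun y : (Fin p × Fin n) ⊕ Fin n → ℝ =>
      ((fun a => y (Sum.inl a), fun j => y (Sum.inr j)) :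
        (Fin p × Fin n → ℝ) × (Fin n → ℝ)) := by fun_prop
  exact h1.comp h2 measurable_id

lemma ae_isUnit_det_gram (h : IsGaussianData μ σ X z) (hpn : n + 2 ≤ p) (t : Fin T) :
    ∀ᵐ ω ∂μ, IsUnit ((X t ω)ᵀ * X t ω).det := by
  have h1 := ContinualLearning.ae_isUnit_det_gram hpn
  rw [← (h.hasLaw_entries t).map_eq] at h1
  exact ae_of_ae_map (h.hasLaw_entries t).aemeasurable h1

end IsGaussianData

end Data

/-! ### The recursion applied to two tasks. -/

section TwoTasks

/-- For `T = 2` the only old task has index `0`, and the weight is `1/(2 - 1) = 1`. -/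
lemma forgetting_two {p : ℕ} (wstar : Fin 2 → EuclideanSpace ℝ (Fin p))
    (w : Fin 3 → EuclideanSpace ℝ (Fin p)) :
    forgetting wstar w = ‖w (Fin.succ 1) - wstar 0‖ ^ 2 - ‖w (Fin.succ 0) - wstar 0‖ ^ 2 := by
  have h : Fin.last 2 = Fin.succ 1 := rfl
  rw [forgetting, Finset.sum_filter, Fin.sum_univ_two, h]
  norm_num [modelError]

lemma generalizationError_two {p : ℕ} (wstar : Fin 2 → EuclideanSpace ℝ (Fin p))
    (w : Fin 3 → EuclideanSpace ℝ (Fin p)) :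
    generalizationError wstar w =
      (‖w (Fin.succ 1) - wstar 0‖ ^ 2 + ‖w (Fin.succ 1) - wstar 1‖ ^ 2) / 2 := by
  have h : Fin.last 2 = Fin.succ 1 := rfl
  rw [generalizationError, Fin.sum_univ_two, h]
  norm_num [modelError]
  ring

/-- The interpolator learned from the first task. -/
noncomputable def firstStep {Ω : Type*} {p n : ℕ} (wstar : Fin 2 → EuclideanSpace ℝ (Fin p))
    (X : Fin 2 → Ω → Matrix (Fin p) (Fin n) ℝ) (z : Fin 2 → Ω → Fin n → ℝ) (ω : Ω) :
    Fin p → ℝ :=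
  step (toMat (entries X 0 ω)) ((toMat (entries X 0 ω))ᵀ *ᵥ (wstar 0).ofLp + z 0 ω) 0

/-- The interpolator learned from the first task and then the second one. -/
noncomputable def secondStep {Ω : Type*} {p n : ℕ} (wstar : Fin 2 → EuclideanSpace ℝ (Fin p))
    (X : Fin 2 → Ω → Matrix (Fin p) (Fin n) ℝ) (z : Fin 2 → Ω → Fin n → ℝ) (ω : Ω) :
    Fin p → ℝ :=
  step (toMat (entries X 1 ω)) ((toMat (entries X 1 ω))ᵀ *ᵥ (wstar 1).ofLp + z 1 ω)
    (firstStep wstar X z ω)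

variable {Ω : Type*} [MeasurableSpace Ω] {μ : Measure Ω} {p n : ℕ} {σ : ℝ}
  {X : Fin 2 → Ω → Matrix (Fin p) (Fin n) ℝ} {z : Fin 2 → Ω → Fin n → ℝ}

lemma integral_firstStep (hpn : n + 2 ≤ p) (wstar : Fin 2 → EuclideanSpace ℝ (Fin p))
    (h : IsGaussianData μ σ X z) (u : Fin p → ℝ) :
    Integrable (fun ω => (firstStep wstar X z ω - u) ⬝ᵥ (firstStep wstar X z ω - u)) μ ∧
      ∫ ω, (firstStep wstar X z ω - u) ⬝ᵥ (firstStep wstar X z ω - u) ∂μ =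
        (1 - n / p) * (u ⬝ᵥ u) + n / p * (((wstar 0).ofLp - u) ⬝ᵥ ((wstar 0).ofLp - u)) +
          σ ^ 2 * (n / ((p : ℝ) - n - 1)) := by
  have := h.indep.isProbabilityMeasure
  have E := integral_step hpn (h.hasLaw_entries 0) (h.hasLaw_noise 0)
    (h.indepFun_entries_noise 0) (v := fun _ => 0) (fun k => memLp_const 0)
    (indepFun_const_left 0 _) (wstar 0).ofLp u
  refine ⟨E.1, E.2.trans ?_⟩
  rw [Real.coe_toNNReal _ (sq_nonneg σ)]
  simp

lemma integral_secondStep (hpn : n + 2 ≤ p) (wstar : Fin 2 → EuclideanSpace ℝ (Fin p))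
    (h : IsGaussianData μ σ X z) (u : Fin p → ℝ) :
    Integrable (fun ω => (secondStep wstar X z ω - u) ⬝ᵥ (secondStep wstar X z ω - u)) μ ∧
      ∫ ω, (secondStep wstar X z ω - u) ⬝ᵥ (secondStep wstar X z ω - u) ∂μ =
        (1 - n / p) * ((1 - n / p) * (u ⬝ᵥ u) +
          n / p * (((wstar 0).ofLp - u) ⬝ᵥ ((wstar 0).ofLp - u)) +
            σ ^ 2 * (n / ((p : ℝ) - n - 1))) +
          n / p * (((wstar 1).ofLp - u) ⬝ᵥ ((wstar 1).ofLp - u)) +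
            σ ^ 2 * (n / ((p : ℝ) - n - 1)) := by
  have hm := (measurable_step (wstar 0).ofLp 0).comp_aemeasurable
    ((h.hasLaw_entries 0).aemeasurable.prodMk (h.hasLaw_noise 0).aemeasurable)
  have hi := (h.indepFun_tasks (by decide : (0 : Fin 2) ≠ 1)).comp
    (measurable_step (wstar 0).ofLp 0) measurable_id
  change AEMeasurable (firstStep wstar X z) μ at hm
  change IndepFun (firstStep wstar X z) (entries X 1) μ at hi
  -- The target `0` turns the squared error of the first model into its squared norm.
  have hL := memLp_of_integrable_dotProduct_self hm
    (by simpa only [sub_zero] using (integral_firstStep hpn wstar h 0).1)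
  have E := integral_step hpn (h.hasLaw_entries 1) (h.hasLaw_noise 1)
    (h.indepFun_entries_noise 1) hL hi (wstar 1).ofLp u
  refine ⟨E.1, E.2.trans ?_⟩
  rw [(integral_firstStep hpn wstar h u).2, Real.coe_toNNReal _ (sq_nonneg σ)]

lemma learnedModels_succ {Ω : Type*} {T p n : ℕ} (wstar : Fin T → EuclideanSpace ℝ (Fin p))
    (X : Fin T → Ω → Matrix (Fin p) (Fin n) ℝ) (z : Fin T → Ω → Fin n → ℝ) (ω : Ω) (t : Fin T) :
    learnedModels wstar X z ω t.succ = train (X t ω) (labels (X t ω) (wstar t) (z t ω))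
      (learnedModels wstar X z ω t.castSucc) :=
  rfl

lemma learnedModels_one {Ω : Type*} {X : Fin 2 → Ω → Matrix (Fin p) (Fin n) ℝ}
    {z : Fin 2 → Ω → Fin n → ℝ} {wstar : Fin 2 → EuclideanSpace ℝ (Fin p)} {ω : Ω}
    (h0 : IsUnit ((X 0 ω)ᵀ * X 0 ω).det) :
    learnedModels wstar X z ω (Fin.succ 0) = WithLp.toLp 2 (firstStep wstar X z ω) := by
  rw [learnedModels_succ, train_eq_step h0]
  rfl

lemma learnedModels_two {Ω : Type*} {X : Fin 2 → Ω → Matrix (Fin p) (Fin n) ℝ}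
    {z : Fin 2 → Ω → Fin n → ℝ} {wstar : Fin 2 → EuclideanSpace ℝ (Fin p)} {ω : Ω}
    (h0 : IsUnit ((X 0 ω)ᵀ * X 0 ω).det) (h1 : IsUnit ((X 1 ω)ᵀ * X 1 ω).det) :
    learnedModels wstar X z ω (Fin.succ 1) = WithLp.toLp 2 (secondStep wstar X z ω) := by
  have h2 : Fin.castSucc (1 : Fin 2) = Fin.succ 0 := rfl
  rw [learnedModels_succ, train_eq_step h1, h2, learnedModels_one h0]
  rfl

lemma norm_sub_sq_eq_dotProduct (a b : EuclideanSpace ℝ (Fin p)) :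
    ‖a - b‖ ^ 2 = (a.ofLp - b.ofLp) ⬝ᵥ (a.ofLp - b.ofLp) := by
  rw [norm_sq_eq_dotProduct, WithLp.ofLp_sub]

end TwoTasks

end ContinualLearning

theorem mainTheorem3 {Ω : Type*} [MeasurableSpace Ω] (μ : Measure Ω) [IsProbabilityMeasure μ]
    (p n : ℕ) (hpn : n + 2 ≤ p) (σ : ℝ) (hσ : 0 ≤ σ)
    (wstar : Fin 2 → EuclideanSpace ℝ (Fin p))
    (X : Fin 2 → Ω → Matrix (Fin p) (Fin n) ℝ) (z : Fin 2 → Ω → Fin n → ℝ)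
    (hdata : ContinualLearning.IsGaussianData μ σ X z)
    (r : ℝ) (hr : r = 1 - (n : ℝ) / (p : ℝ)) :
    (∀ᵐ ω ∂μ, ∀ t : Fin 2, ∀ w : EuclideanSpace ℝ (Fin p),
      ContinualLearning.IsMinChange (X t ω)
          (ContinualLearning.labels (X t ω) (wstar t) (z t ω))
          (ContinualLearning.learnedModels wstar X z ω t.castSucc) w ↔
        w = ContinualLearning.learnedModels wstar X z ω t.succ) ∧
    Integrable (fun ω => ContinualLearning.forgetting wstar
      (ContinualLearning.learnedModels wstar X z ω)) μ ∧
    ∫ ω, ContinualLearning.forgetting wstar (ContinualLearning.learnedModels wstar X z ω) ∂μ =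
      (r ^ 2 - r) * ‖wstar 0‖ ^ 2 + (n : ℝ) / (p : ℝ) * ‖wstar 1 - wstar 0‖ ^ 2
        + (n : ℝ) * r * σ ^ 2 / ((p : ℝ) - (n : ℝ) - 1) ∧
    Integrable (fun ω => ContinualLearning.generalizationError wstar
      (ContinualLearning.learnedModels wstar X z ω)) μ ∧
    ∫ ω, ContinualLearning.generalizationError wstar
        (ContinualLearning.learnedModels wstar X z ω) ∂μ =
      r ^ 2 / 2 * (‖wstar 0‖ ^ 2 + ‖wstar 1‖ ^ 2)
        + (1 - r ^ 2) / 2 * ‖wstar 0 - wstar 1‖ ^ 2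
        + (p : ℝ) * σ ^ 2 * (1 - r ^ 2) / ((p : ℝ) - (n : ℝ) - 1) := by
  open ContinualLearning in
  have hunit := hdata.ae_isUnit_det_gram hpn
  have E₁ := integral_firstStep hpn wstar hdata
  have E₂ := integral_secondStep hpn wstar hdata
  have hF : (fun ω => forgetting wstar (learnedModels wstar X z ω)) =ᵐ[μ] fun ω =>
      (secondStep wstar X z ω - (wstar 0).ofLp) ⬝ᵥ (secondStep wstar X z ω - (wstar 0).ofLp) -
        (firstStep wstar X z ω - (wstar 0).ofLp) ⬝ᵥ (firstStep wstar X z ω - (wstar 0).ofLp) := by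
    filter_upwards [hunit 0, hunit 1] with ω h0 h1
    rw [forgetting_two, learnedModels_one h0, learnedModels_two h0 h1, norm_sub_sq_eq_dotProduct,
      norm_sub_sq_eq_dotProduct]
  have hG : (fun ω => generalizationError wstar (learnedModels wstar X z ω)) =ᵐ[μ] fun ω =>
      ((secondStep wstar X z ω - (wstar 0).ofLp) ⬝ᵥ (secondStep wstar X z ω - (wstar 0).ofLp) +
        (secondStep wstar X z ω - (wstar 1).ofLp) ⬝ᵥ
          (secondStep wstar X z ω - (wstar 1).ofLp)) / 2 := by
    filter_upwards [hunit 0, hunit 1] with ω h0 h1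
    rw [generalizationError_two, learnedModels_two h0 h1, norm_sub_sq_eq_dotProduct,
      norm_sub_sq_eq_dotProduct]
  have hp : (p : ℝ) ≠ 0 := by
    have : 0 < p := by omega
    positivity
  have hd : (p : ℝ) - n - 1 ≠ 0 := by
    have : (n : ℝ) + 2 ≤ p := by exact_mod_cast hpn
    linarith
  refine ⟨?_, ((E₂ _).1.sub (E₁ _).1).congr hF.symm, ?_,
    (((E₂ _).1.add (E₂ _).1).div_const 2).congr hG.symm, ?_⟩
  · filter_upwards [hunit 0, hunit 1] with ω h0 h1 t w
    have ht : IsUnit ((X t ω)ᵀ * X t ω).det := by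
      fin_cases t
      · exact h0
      · exact h1
    rw [isMinChange_iff ht, learnedModels_succ, train_eq_step ht]
  -- At `u = w₁*` the first task's truth term vanishes; the noise contributes `r nσ²/(p - n - 1)`
  -- after cancelling one of two equal terms.
  · rw [integral_congr_ae hF, integral_sub (E₂ _).1 (E₁ _).1, (E₂ _).2, (E₁ _).2,
      norm_sq_eq_dotProduct (wstar 0), norm_sub_sq_eq_dotProduct, hr, sub_self, zero_dotProduct]
    field_simp
    ring
  -- The noise terms add up to `(1 + r) n σ²/(p - n - 1)`, and `n (1 + r) = p (1 - r²)` since `1 - r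
  -- = n/p`.
  · rw [integral_congr_ae hG, integral_div, integral_add (E₂ _).1 (E₂ _).1, (E₂ _).2, (E₂ _).2,
      norm_sq_eq_dotProduct (wstar 0), norm_sq_eq_dotProduct (wstar 1),
      norm_sub_sq_eq_dotProduct, hr, sub_self, sub_self, zero_dotProduct,
      ← neg_sub (wstar 0).ofLp (wstar 1).ofLp, neg_dotProduct, dotProduct_neg, neg_neg]
    field_simp
    ring
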